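/- For $m,n\in\mathbb N=\{0,1,2,\ldots\}$ let $\mathcal B_{mn}$ be the set of Brauer partitions, i.e. set partitions of $\{1,\ldots,m\}\cup\{1',\ldots,n'\}$ all of whose blocks have size $2$. The product $\alpha\beta\in\mathcal B_{mk}$ of $\alpha\in\mathcal B_{mn}$ and $\beta\in\mathcal B_{nk}$ is obtained by identifying the lower vertices of $\alpha$ with the upper vertices of $\beta$ and recording which of the remaining vertices lie in the same connected component of the resulting graph. These products make $\mathcal B=\bigcup_{m,n}\mathcal B_{mn}$ a category (the Brauer category). Let $m,n\in\mathbb N$ and $\sigma\in\mathcal B_{nm}$, and let $\mathcal B_{mn}^\sigma$ be the sandwich semigroup with underlying set $\mathcal B_{mn}$ and operation $\alpha\star_\sigma\beta=\alpha\sigma\beta$. Its (von Neumann) regular elements form a subsemigroup $P^\sigma=\operatorname{Reg}(\mathcal B_{mn}^\sigma)$. Let $P_2^\sigma=\{\alpha\in\mathcal B_{mn}:\sigma\alpha\mathrel{\mathscr L}\alpha\}$, where $\mathscr L$ is Green's relation on $\mathcal B$: $\alpha\mathrel{\mathscr L}\beta$ if and only if $\alpha=\gamma\beta$ and $\beta=\delta\alpha$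 for some $\gamma,\delta\in\mathcal B$. A mid-identity of a semigroup $T$ is an element $u\in T$ with $xy=xuy$ for all $x,y\in T$; idempotents $e,f$ of $T$ satisfy $e\preceq f$ if and only if $e=ef=fe$; and $T$ is MI-dominated if it is regular and every idempotent of $T$ is $\preceq$-below a mid-identity of $T$. Then the semigroup $P^\sigma$ is MI-dominated. Moreover, for each $\alpha\in P_2^\sigma$ there is a mid-identity $\lambda$ of $P^\sigma$ with $\alpha=\lambda\sigma\alpha$ $(=\lambda\star_\sigma\alpha)$. -/

import Mathlib

namespace SandwichBrauer

/-! ### The partition category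

A set partition of `[m] ∪ [n]'` is encoded by the equivalence relation whose classes are its blocks:
`Sum.inl i` is the upper vertex `i`, and `Sum.inr j` is the lower vertex `j'`. -/

/-- The set of all set partitions of `[m] ∪ [n]'`. -/
abbrev Partn (m n : ℕ) : Type := Setoid (Fin m ⊕ Fin n)

/-- The vertices `[m] ∪ [n]'' ∪ [k]'` of a product graph; the middle summand is `[n]''`. -/
abbrev ProductVertex (m n k : ℕ) : Type := Fin m ⊕ (Fin n ⊕ Fin k)

/-- Renaming of the vertices `[m] ∪ [n]'` to `[m] ∪ [n]''`. -/
def topVertex {m n : ℕ} (k : ℕ) : Fin m ⊕ Fin n → ProductVertex m n k :=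
  Sum.map id Sum.inl

/-- Renaming of the vertices `[n] ∪ [k]'` to `[n]'' ∪ [k]'`. -/
def bottomVertex (m : ℕ) {n k : ℕ} : Fin n ⊕ Fin k → ProductVertex m n k :=
  Sum.inr

/-- The inclusion of `[m] ∪ [k]'` into `[m] ∪ [n]'' ∪ [k]'`. -/
def outerVertex {m : ℕ} (n : ℕ) {k : ℕ} : Fin m ⊕ Fin k → ProductVertex m n k :=
  Sum.map id Sum.inr

/-- The edges of the product graph of `α` and `β`. -/
inductive ProductEdge {m n k : ℕ} (α : Partn m n) (β : Partn n k) :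
    ProductVertex m n k → ProductVertex m n k → Prop
  | top {x y : Fin m ⊕ Fin n} (h : α x y) : ProductEdge α β (topVertex k x) (topVertex k y)
  | bottom {x y : Fin n ⊕ Fin k} (h : β x y) :
      ProductEdge α β (bottomVertex m x) (bottomVertex m y)

/-- The product of two partitions: two vertices of `[m] ∪ [k]'` lie in the same block if and only if
they lie in the same connected component of the product graph. -/
@[reducible] def Partn.comp {m n k : ℕ} (α : Partn m n) (β : Partn n k) : Partn m k :=
  Setoid.comap (outerVertex n) (Relation.EqvGen.setoid (ProductEdge α β))

/-- The involution of the partition category, which swaps the two rows of vertices. -/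
@[reducible] def Partn.star {m n : ℕ} (α : Partn m n) : Partn n m :=
  Setoid.comap Sum.swap α

/-- A Brauer partition is a partition each of whose blocks has size `2`. -/
def Partn.IsBrauer {m n : ℕ} (α : Partn m n) : Prop :=
  ∀ B ∈ α.classes, B.ncard = 2

/-! ### The product of partitions is associative -/

/-- The four rows of vertices that occur in a product of three partitions. -/
abbrev TripleVertex (m n k l : ℕ) : Type := Fin m ⊕ (Fin n ⊕ (Fin k ⊕ Fin l))

inductive TripleEdge {m n k l : ℕ} (α : Partn m n) (β : Partn n k) (γ : Partn k l) :
    TripleVertex m n k l → TripleVertex m n k l → Prop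
  | fst {x y : Fin m ⊕ Fin n} (h : α x y) :
      TripleEdge α β γ (Sum.map id Sum.inl x) (Sum.map id Sum.inl y)
  | snd {x y : Fin n ⊕ Fin k} (h : β x y) :
      TripleEdge α β γ (Sum.inr (Sum.map id Sum.inl x)) (Sum.inr (Sum.map id Sum.inl y))
  | trd {x y : Fin k ⊕ Fin l} (h : γ x y) :
      TripleEdge α β γ (Sum.inr (Sum.inr x)) (Sum.inr (Sum.inr y))

theorem eqvGen_map {X Y : Type*} {r : X → X → Prop} {s : Y → Y → Prop} (f : X → Y)
    (h : ∀ x y, r x y → Relation.EqvGen s (f x) (f y)) {x y : X} (hxy : Relation.EqvGen r x y) :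
    Relation.EqvGen s (f x) (f y) := by
  induction hxy with
  | rel x y hr => exact h x y hr
  | refl x => exact .refl _
  | symm x y _ ih => exact .symm _ _ ih
  | trans x y z _ _ ih1 ih2 => exact .trans _ _ _ ih1 ih2

/-- Elimination of the vertices outside the range of `i` from a graph whose edges are those of `A`
together with those of `B`, the latter joining only vertices in the range of `i`. -/
theorem eqvGen_eliminate {X Y : Type*} (i : Y → X) {r A : X → X → Prop} {s : Y → Y → Prop}
    (hA : ∀ y z, Relation.EqvGen A (i y) (i z) → Relation.EqvGen s y z)
    (hr : ∀ u v, r u v → A u v ∨ ∃ y z, u = i y ∧ v = i z ∧ s y z)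
    {y z : Y} (h : Relation.EqvGen r (i y) (i z)) : Relation.EqvGen s y z := by
  have key : ∀ u v, Relation.EqvGen r u v →
      ((∃ w, Relation.EqvGen A u (i w) ∧ Relation.EqvGen s y w) ↔
        (∃ w, Relation.EqvGen A v (i w) ∧ Relation.EqvGen s y w)) := by
    intro u v huv
    induction huv with
    | rel u v huv =>
      rcases hr u v huv with h1 | ⟨p, q, rfl, rfl, h1⟩
      · constructor
        · rintro ⟨w, h2, h3⟩
          exact ⟨w, .trans _ _ _ (.symm _ _ (.rel _ _ h1)) h2, h3⟩
        · rintro ⟨w, h2, h3⟩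
          exact ⟨w, .trans _ _ _ (.rel _ _ h1) h2, h3⟩
      · constructor
        · rintro ⟨w, h2, h3⟩
          exact ⟨q, .refl _, .trans _ _ _ (.trans _ _ _ h3 (.symm _ _ (hA _ _ h2))) (.rel _ _ h1)⟩
        · rintro ⟨w, h2, h3⟩
          exact ⟨p, .refl _,
            .trans _ _ _ (.trans _ _ _ h3 (.symm _ _ (hA _ _ h2))) (.symm _ _ (.rel _ _ h1))⟩
    | refl u => rfl
    | symm u v _ ih => exact ih.symm
    | trans u v w _ _ ih1 ih2 => exact ih1.trans ih2
  obtain ⟨w, h1, h2⟩ := (key _ _ h).1 ⟨y, .refl _, .refl _⟩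
  exact .trans _ _ _ h2 (.symm _ _ (hA _ _ h1))

/-- Two vertices that are connected by edges between vertices in the range of an injection are equal
or are images of connected vertices. -/
theorem eqvGen_of_range {X Y : Type*} (j : Y → X) (hj : Function.Injective j)
    {A : X → X → Prop} {s : Y → Y → Prop}
    (hA : ∀ u v, A u v → ∃ y z, u = j y ∧ v = j z ∧ s y z) {u v : X}
    (h : Relation.EqvGen A u v) :
    u = v ∨ ∃ y z, u = j y ∧ v = j z ∧ Relation.EqvGen s y z := by
  induction h with
  | rel u v h =>
    obtain ⟨y, z, h1, h2, h3⟩ := hA u v h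
    exact .inr ⟨y, z, h1, h2, .rel _ _ h3⟩
  | refl u => exact .inl rfl
  | symm u v _ ih =>
    rcases ih with rfl | ⟨y, z, h1, h2, h3⟩
    · exact .inl rfl
    · exact .inr ⟨z, y, h2, h1, .symm _ _ h3⟩
  | trans u v w _ _ ih1 ih2 =>
    rcases ih1 with rfl | ⟨y, z, h1, h2, h3⟩
    · exact ih2
    · rcases ih2 with rfl | ⟨y', z', h1', h2', h3'⟩
      · exact .inr ⟨y, z, h1, h2, h3⟩
      · obtain rfl : z = y' := hj (h2.symm.trans h1')
        exact .inr ⟨y, z', h1, h2', .trans _ _ _ h3 h3'⟩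

theorem comp_comp_left {m n k l : ℕ} (α : Partn m n) (β : Partn n k) (γ : Partn k l)
    (x y : Fin m ⊕ Fin l) : Partn.comp (Partn.comp α β) γ x y ↔
      Relation.EqvGen (TripleEdge α β γ) (Sum.map id (Sum.inr ∘ Sum.inr) x)
        (Sum.map id (Sum.inr ∘ Sum.inr) y) := by
  let i : ProductVertex m k l → TripleVertex m n k l := Sum.map id Sum.inr
  let j : ProductVertex m n k → TripleVertex m n k l := Sum.map id (Sum.map id Sum.inl)
  have hj : Function.Injective j := by
    rintro (a | a | a) (b | b | b) h <;> simp_all [j]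
  have hio : ∀ x : Fin m ⊕ Fin l,
      i (outerVertex k x) = Sum.map id (Sum.inr ∘ Sum.inr) x := by
    rintro (a | a) <;> rfl
  have hjo : ∀ x : Fin m ⊕ Fin k, j (outerVertex n x) = i (topVertex l x) := by
    rintro (a | a) <;> rfl
  have hjt : ∀ x : Fin m ⊕ Fin n, j (topVertex k x) = Sum.map id Sum.inl x := by
    rintro (a | a) <;> rfl
  rw [← hio, ← hio]
  constructor
  · intro h
    refine eqvGen_map i ?_ (show Relation.EqvGen _ (outerVertex k x) (outerVertex k y) from h)
    rintro _ _ (⟨h⟩ | ⟨h⟩)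
    · rw [← hjo, ← hjo]
      refine eqvGen_map j ?_ h
      rintro _ _ (⟨h⟩ | ⟨h⟩)
      · rw [hjt, hjt]
        exact .rel _ _ (TripleEdge.fst h)
      · exact .rel _ _ (TripleEdge.snd h)
    · exact .rel _ _ (TripleEdge.trd h)
  · intro h
    let A : TripleVertex m n k l → TripleVertex m n k l → Prop := fun u v =>
      ∃ p q, u = j p ∧ v = j q ∧ ProductEdge α β p q
    refine eqvGen_eliminate (A := A) i ?_ ?_ h
    · intro y z hyz
      rcases eqvGen_of_range j hj (fun u v h => h) hyz with h | ⟨p, q, h1, h2, h3⟩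
      · have hi : Function.Injective i := by
          rintro (a | a | a) (b | b | b) h <;> simp_all [i]
        rw [hi h]
        exact .refl _
      · have aux : ∀ (y : ProductVertex m k l) (p : ProductVertex m n k), i y = j p →
            ∃ o : Fin m ⊕ Fin k, y = topVertex l o ∧ p = outerVertex n o := by
          rintro (a | a | a) (b | b | b) h
          all_goals simp [i, j] at h
          · exact ⟨.inl a, rfl, by simp [outerVertex, h]⟩
          · exact ⟨.inr a, rfl, by simp [outerVertex, h]⟩
        obtain ⟨o, rfl, rfl⟩ := aux _ _ h1
        obtain ⟨o', rfl, rfl⟩ := aux _ _ h2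
        exact .rel _ _ (.top h3)
    · rintro _ _ (⟨h⟩ | ⟨h⟩ | ⟨h⟩)
      · rename_i a b
        refine .inl ⟨topVertex k a, topVertex k b, ?_, ?_, .top h⟩
        · rcases a with a | a <;> rfl
        · rcases b with b | b <;> rfl
      · exact .inl ⟨_, _, rfl, rfl, .bottom h⟩
      · exact .inr ⟨_, _, rfl, rfl, .bottom h⟩

theorem comp_comp_right {m n k l : ℕ} (α : Partn m n) (β : Partn n k) (γ : Partn k l)
    (x y : Fin m ⊕ Fin l) : Partn.comp α (Partn.comp β γ) x y ↔
      Relation.EqvGen (TripleEdge α β γ) (Sum.map id (Sum.inr ∘ Sum.inr) x)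
        (Sum.map id (Sum.inr ∘ Sum.inr) y) := by
  let i : ProductVertex m n l → TripleVertex m n k l := Sum.map id (Sum.map id Sum.inr)
  let j : ProductVertex n k l → TripleVertex m n k l := Sum.inr
  have hj : Function.Injective j := Sum.inr_injective
  have hio : ∀ x : Fin m ⊕ Fin l,
      i (outerVertex n x) = Sum.map id (Sum.inr ∘ Sum.inr) x := by
    rintro (a | a) <;> rfl
  have hjo : ∀ x : Fin n ⊕ Fin l, j (outerVertex k x) = i (bottomVertex m x) := by
    rintro (a | a) <;> rfl
  rw [← hio, ← hio]
  constructor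
  · intro h
    refine eqvGen_map i ?_ (show Relation.EqvGen _ (outerVertex n x) (outerVertex n y) from h)
    rintro _ _ (⟨h⟩ | ⟨h⟩)
    · rename_i a b
      have := TripleEdge.fst (β := β) (γ := γ) h
      convert Relation.EqvGen.rel _ _ this using 1
      · rcases a with a | a <;> rfl
      · rcases b with b | b <;> rfl
    · rw [← hjo, ← hjo]
      refine eqvGen_map j ?_ h
      rintro _ _ (⟨h⟩ | ⟨h⟩)
      · exact .rel _ _ (TripleEdge.snd h)
      · exact .rel _ _ (TripleEdge.trd h)
  · intro h
    let A : TripleVertex m n k l → TripleVertex m n k l → Prop := fun u v =>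
      ∃ p q, u = j p ∧ v = j q ∧ ProductEdge β γ p q
    refine eqvGen_eliminate (A := A) i ?_ ?_ h
    · intro y z hyz
      rcases eqvGen_of_range j hj (fun u v h => h) hyz with h | ⟨p, q, h1, h2, h3⟩
      · have hi : Function.Injective i := by
          rintro (a | a | a) (b | b | b) h <;> simp_all [i]
        rw [hi h]
        exact .refl _
      · have aux : ∀ (y : ProductVertex m n l) (p : ProductVertex n k l), i y = j p →
            ∃ o : Fin n ⊕ Fin l, y = bottomVertex m o ∧ p = outerVertex k o := by
          rintro (a | a | a) (b | b | b) h
          all_goals simp [i, j] at h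
          · exact ⟨.inl a, rfl, by simp [outerVertex, h]⟩
          · exact ⟨.inr a, rfl, by simp [outerVertex, h]⟩
        obtain ⟨o, rfl, rfl⟩ := aux _ _ h1
        obtain ⟨o', rfl, rfl⟩ := aux _ _ h2
        exact .rel _ _ (.bottom h3)
    · rintro _ _ (⟨h⟩ | ⟨h⟩ | ⟨h⟩)
      · rename_i a b
        refine .inr ⟨topVertex l a, topVertex l b, ?_, ?_, .top h⟩
        · rcases a with a | a <;> rfl
        · rcases b with b | b <;> rfl
      · exact .inl ⟨topVertex l _, topVertex l _, rfl, rfl, .top h⟩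
      · exact .inl ⟨bottomVertex n _, bottomVertex n _, rfl, rfl, .bottom h⟩

theorem Partn.comp_assoc {m n k l : ℕ} (α : Partn m n) (β : Partn n k) (γ : Partn k l) :
    Partn.comp (Partn.comp α β) γ = Partn.comp α (Partn.comp β γ) :=
  Setoid.ext fun x y => (comp_comp_left α β γ x y).trans (comp_comp_right α β γ x y).symm

theorem Partn.comp_star_comp {m n : ℕ} (α : Partn m n) :
    Partn.comp (Partn.comp α (Partn.star α)) α = α := by
  refine Setoid.ext fun x y => (comp_comp_left _ _ _ x y).trans ⟨fun h => ?_, fun h => ?_⟩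
  · let f : TripleVertex m n m n → Fin m ⊕ Fin n :=
      Sum.elim Sum.inl (Sum.elim Sum.inr id)
    have hf : ∀ x : Fin m ⊕ Fin n, f (Sum.map id (Sum.inr ∘ Sum.inr) x) = x := by
      rintro (a | a) <;> rfl
    have key : ∀ u v, Relation.EqvGen (TripleEdge α (Partn.star α) α) u v → α (f u) (f v) := by
      intro u v huv
      induction huv with
      | rel u v h =>
        rcases h with ⟨h⟩ | ⟨h⟩ | ⟨h⟩
        · rename_i a b
          rcases a with a | a <;> rcases b with b | b <;> exact h
        · rename_i a b
          rcases a with a | a <;> rcases b with b | b <;> exact h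
        · exact h
      | refl u => exact α.refl' _
      | symm u v _ ih => exact α.symm' ih
      | trans u v w _ _ ih1 ih2 => exact α.trans' ih1 ih2
    simpa only [hf] using key _ _ h
  · have ul : ∀ (a : Fin m) (b : Fin n), α (.inl a) (.inr b) →
        Relation.EqvGen (TripleEdge α (Partn.star α) α) (.inl a) (.inr (.inr (.inr b))) := by
      intro a b h
      have e1 := TripleEdge.fst (β := Partn.star α) (γ := α) h
      have e2 := TripleEdge.snd (α := α) (β := Partn.star α) (γ := α) (x := .inl b) (y := .inr a)
        (α.symm' h)
      have e3 := TripleEdge.trd (α := α) (β := Partn.star α) h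
      exact .trans _ _ _ (.rel _ _ e1) (.trans _ _ _ (.rel _ _ e2) (.rel _ _ e3))
    rcases x with a | a <;> rcases y with b | b
    · exact .rel _ _ (TripleEdge.fst h)
    · exact ul a b h
    · exact .symm _ _ (ul b a (α.symm' h))
    · exact .rel _ _ (TripleEdge.trd h)

/-! ### Brauer partitions are closed under products and the involution -/

theorem two_fixed_points {V : Type*} [Finite V] (a b : Equiv.Perm V)
    (ha : ∀ v, a (a v) = v) (hb : ∀ v, b (b v) = v) (x : V) (hbx : b x = x) (hax : a x ≠ x) :
    ∃ y, y ≠ x ∧ (a y = y ∨ b y = y) ∧ Relation.EqvGen (fun u v => v = a u ∨ v = b u) x y ∧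
      ∀ z, Relation.EqvGen (fun u v => v = a u ∨ v = b u) x z → (a z = z ∨ b z = z) →
        z = x ∨ z = y := by
  set c : Equiv.Perm V := a * b with hc
  have ha' : a⁻¹ = a := inv_eq_of_mul_eq_one_left (Equiv.ext ha)
  have hb' : b⁻¹ = b := inv_eq_of_mul_eq_one_left (Equiv.ext hb)
  have hbc : ∀ i : ℤ, b ((c ^ i) x) = (c ^ (-i)) x := by
    intro i
    have h : b * c ^ i * b⁻¹ = c ^ (-i) := by
      rw [← conj_zpow, zpow_neg, ← inv_zpow, hc, mul_inv_rev, ha', hb']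
      congr 1
      rw [← mul_assoc, mul_assoc, show b * b = 1 from Equiv.ext hb, mul_one]
    calc b ((c ^ i) x) = (b * c ^ i * b⁻¹) x := by simp [hb', hbx]
      _ = _ := by rw [h]
  have hac : ∀ i : ℤ, a ((c ^ i) x) = (c ^ (1 - i)) x := by
    intro i
    have h1 : a ((c ^ i) x) = c (b ((c ^ i) x)) := by simp [hc, hb]
    rw [h1, hbc, sub_eq_add_neg, zpow_one_add]
    rfl
  set N : ℕ := Function.minimalPeriod c x with hN
  have hper : ∀ i j : ℤ, (c ^ i) x = (c ^ j) x ↔ (N : ℤ) ∣ i - j := by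
    intro i j
    have h := MulAction.zpow_smul_eq_iff_minimalPeriod_dvd (a := c) (b := x) (n := i - j)
    have hN' : (Function.minimalPeriod (fun v => c • v) x) = N := rfl
    rw [hN'] at h
    rw [← h, Equiv.Perm.smul_def, sub_eq_neg_add, zpow_add, zpow_neg, Equiv.Perm.mul_apply,
      Equiv.Perm.inv_eq_iff_eq]
  have hNpos : 0 < N :=
    Function.minimalPeriod_pos_of_mem_periodicPts (c.injective.mem_periodicPts x)
  have hconn : ∀ i : ℕ, Relation.EqvGen (fun u v => v = a u ∨ v = b u) x ((c ^ (i : ℤ)) x) := by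
    intro i
    induction i with
    | zero => exact .refl _
    | succ i ih =>
      refine .trans _ _ _ ih (.trans _ (b ((c ^ (i : ℤ)) x)) _ (.rel _ _ (.inr rfl))
        (.rel _ _ (.inl ?_)))
      rw [Nat.cast_succ, add_comm, zpow_one_add]
      rfl
  have horb : ∀ z, Relation.EqvGen (fun u v => v = a u ∨ v = b u) x z →
      ∃ i : ℤ, z = (c ^ i) x := by
    have key : ∀ u v, Relation.EqvGen (fun u v => v = a u ∨ v = b u) u v →
        ((∃ i : ℤ, u = (c ^ i) x) ↔ ∃ i : ℤ, v = (c ^ i) x) := by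
      intro u v huv
      induction huv with
      | rel u v h =>
        rcases h with rfl | rfl
        · constructor
          · rintro ⟨i, rfl⟩
            exact ⟨_, hac i⟩
          · rintro ⟨i, h⟩
            exact ⟨1 - i, by rw [← hac, ← h, ha]⟩
        · constructor
          · rintro ⟨i, rfl⟩
            exact ⟨_, hbc i⟩
          · rintro ⟨i, h⟩
            exact ⟨-i, by rw [← hbc, ← h, hb]⟩
      | refl u => rfl
      | symm u v _ ih => exact ih.symm
      | trans u v w _ _ ih1 ih2 => exact ih1.trans ih2
    intro z hz
    exact (key _ _ hz).1 ⟨0, rfl⟩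
  have hN1 : N ≠ 1 := by
    intro h1
    have h2 := (hper 1 0).2 (by rw [h1]; simp)
    apply hax
    have h3 := hac 0
    simp only [sub_zero, zpow_zero, Equiv.Perm.coe_one, id_eq] at h2 h3
    rw [h3, h2]
  have hx0 : x = (c ^ (0 : ℤ)) x := rfl
  rcases Nat.even_or_odd' N with ⟨d, hd | hd⟩
  · refine ⟨(c ^ (d : ℤ)) x, ?_, .inr ?_, hconn d, ?_⟩
    · intro h
      have h2 := (hper d 0).1 h
      rw [sub_zero] at h2
      have := Nat.le_of_dvd (by omega) (Int.natCast_dvd_natCast.1 h2)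
      omega
    · rw [hbc, hper]
      exact ⟨-1, by rw [hd]; push_cast; ring⟩
    · intro z hz hfix
      obtain ⟨i, rfl⟩ := horb z hz
      rw [hac, hbc, hper, hper] at hfix
      rcases hfix with ⟨t, ht⟩ | ⟨t, ht⟩
      · exfalso
        rw [hd] at ht
        push_cast at ht
        have : (1 : ℤ) = 2 * (i + d * t) := by linarith
        omega
      · have hi : i = -(d * t) := by
          rw [hd] at ht
          push_cast at ht
          linarith
        rcases Int.even_or_odd' t with ⟨s, hs | hs⟩
        · left
          refine (hper i 0).2 ⟨-s, ?_⟩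
          rw [hi, hs, hd]
          push_cast
          ring
        · right
          refine (hper i d).2 ⟨-s - 1, ?_⟩
          rw [hi, hs, hd]
          push_cast
          ring
  · refine ⟨(c ^ ((d + 1 : ℕ) : ℤ)) x, ?_, .inl ?_, hconn (d + 1), ?_⟩
    · intro h
      have h2 := (hper (d + 1 : ℕ) 0).1 h
      rw [sub_zero] at h2
      have := Nat.le_of_dvd (by omega) (Int.natCast_dvd_natCast.1 h2)
      omega
    · rw [hac, hper]
      exact ⟨-1, by rw [hd]; push_cast; ring⟩
    · intro z hz hfix
      obtain ⟨i, rfl⟩ := horb z hz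
      rw [hac, hbc, hper, hper] at hfix
      rcases hfix with ⟨t, ht⟩ | ⟨t, ht⟩
      · right
        rw [hd] at ht
        push_cast at ht
        rcases Int.even_or_odd' t with ⟨s, hs | hs⟩
        · exfalso
          have : (1 : ℤ) = 2 * (i + (2 * d + 1) * s) := by rw [hs] at ht; linarith
          omega
        · refine (hper i (d + 1 : ℕ)).2 ⟨-s - 1, ?_⟩
          rw [hd]
          rw [hs] at ht
          push_cast
          linarith
      · left
        rw [hd] at ht
        push_cast at ht
        rcases Int.even_or_odd' t with ⟨s, hs | hs⟩
        · refine (hper i 0).2 ⟨-s, ?_⟩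
          rw [hd]
          rw [hs] at ht
          push_cast
          linarith
        · exfalso
          have : (1 : ℤ) = 2 * (-i - d * (2 * s + 1) - s) := by rw [hs] at ht; linarith
          omega

/-- In a partition into blocks of size `2`, the map to the other element of the block. -/
theorem exists_partner {X : Type*} (r : Setoid X) (h : ∀ B ∈ r.classes, B.ncard = 2) :
    ∃ f : Equiv.Perm X, (∀ x, f (f x) = x) ∧ (∀ x, f x ≠ x) ∧
      ∀ x y, r x y ↔ y = x ∨ y = f x := by
  have h1 : ∀ x, ∃ y, y ≠ x ∧ ∀ z, r z x ↔ z = x ∨ z = y := by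
    intro x
    obtain ⟨p, q, hpq, hB⟩ := Set.ncard_eq_two.1 (h _ (Setoid.mem_classes r x))
    have hz : ∀ z, r z x ↔ z = p ∨ z = q := fun z => by
      simpa using Set.ext_iff.1 hB z
    rcases (hz x).1 (r.refl' x) with rfl | rfl
    · exact ⟨q, hpq.symm, hz⟩
    · exact ⟨p, hpq, fun z => (hz z).trans or_comm⟩
  choose f hf1 hf2 using h1
  have hff : ∀ x, f (f x) = x := by
    intro x
    have h2 : r x (f x) := r.symm' ((hf2 x (f x)).2 (.inr rfl))
    rcases (hf2 (f x) x).1 h2 with h3 | h3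
    · exact absurd h3.symm (hf1 x)
    · exact h3.symm
  exact ⟨⟨f, f, hff, hff⟩, hff, hf1, fun x y => ⟨fun hxy => (hf2 x y).1 (r.symm' hxy),
    fun hxy => r.symm' ((hf2 x y).2 hxy)⟩⟩

theorem ncard_of_partner {X : Type*} (r : Setoid X)
    (h : ∀ x, ∃ y, y ≠ x ∧ ∀ z, r x z ↔ z = x ∨ z = y) : ∀ B ∈ r.classes, B.ncard = 2 := by
  rintro B ⟨x, rfl⟩
  obtain ⟨y, hy, hz⟩ := h x
  refine Set.ncard_eq_two.2 ⟨x, y, hy.symm, ?_⟩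
  ext z
  simpa using (⟨r.symm', r.symm'⟩ : r z x ↔ r x z).trans (hz z)

theorem Partn.IsBrauer.comp {m n k : ℕ} {α : Partn m n} {β : Partn n k} (hα : α.IsBrauer)
    (hβ : β.IsBrauer) : (Partn.comp α β).IsBrauer := by
  obtain ⟨f, hff, hf, hfα⟩ := exists_partner α hα
  obtain ⟨g, hgg, hg, hgβ⟩ := exists_partner β hβ
  let e := Equiv.sumAssoc (Fin m) (Fin n) (Fin k)
  let a : Equiv.Perm (ProductVertex m n k) := e.permCongr (Equiv.sumCongr f 1)
  let b : Equiv.Perm (ProductVertex m n k) := Equiv.sumCongr 1 g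
  have hea : ∀ x : Fin m ⊕ Fin n, e (.inl x) = topVertex k x := by
    rintro (x | x) <;> rfl
  have hat : ∀ x, a (topVertex k x) = topVertex k (f x) := by
    intro x
    rw [← hea, ← hea]
    simp [a]
  have hao : ∀ x, a (.inr (.inr x)) = .inr (.inr x) := by
    intro x
    rw [show (.inr (.inr x) : ProductVertex m n k) = e (.inr x) from rfl]
    simp [a]
  have hbt : ∀ x, b (bottomVertex m x) = bottomVertex m (g x) := fun x => rfl
  have hbo : ∀ x, b (.inl x) = .inl x := fun x => rfl
  have htop : ∀ v : ProductVertex m n k, (∃ x, v = topVertex k x) ∨ ∃ x, v = .inr (.inr x) := by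
    rintro (v | v | v)
    · exact .inl ⟨.inl v, rfl⟩
    · exact .inl ⟨.inr v, rfl⟩
    · exact .inr ⟨v, rfl⟩
  have htinj : Function.Injective (topVertex k : Fin m ⊕ Fin n → _) := by
    rintro (x | x) (y | y) h <;> simp_all [topVertex]
  have haa : ∀ v, a (a v) = v := by
    intro v
    rcases htop v with ⟨x, rfl⟩ | ⟨x, rfl⟩
    · rw [hat, hat, hff]
    · rw [hao, hao]
  have hbb : ∀ v, b (b v) = v := by
    rintro (v | v)
    · rfl
    · exact congrArg Sum.inr (hgg v)
  have hafix : ∀ v, a v = v ↔ ∃ x, v = .inr (.inr x) := by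
    intro v
    rcases htop v with ⟨x, rfl⟩ | ⟨x, rfl⟩
    · rw [hat]
      refine ⟨fun h => absurd (htinj h) (hf x), ?_⟩
      rintro ⟨y, hy⟩
      rcases x with x | x <;> simp [topVertex] at hy
    · simp [hao]
  have hbfix : ∀ v, b v = v ↔ ∃ x, v = .inl x := by
    rintro (v | v)
    · simp [hbo]
    · refine ⟨fun h => absurd (Sum.inr_injective h) (hg v), ?_⟩
      rintro ⟨y, hy⟩
      simp at hy
  have hE : ∀ u v, Relation.EqvGen (ProductEdge α β) u v ↔
      Relation.EqvGen (fun u v => v = a u ∨ v = b u) u v := by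
    intro u v
    constructor
    · refine eqvGen_map id ?_
      rintro _ _ (⟨h⟩ | ⟨h⟩)
      · rcases (hfα _ _).1 h with rfl | rfl
        · exact .refl _
        · exact .rel _ _ (.inl (hat _).symm)
      · rcases (hgβ _ _).1 h with rfl | rfl
        · exact .refl _
        · exact .rel _ _ (.inr (hbt _).symm)
    · refine eqvGen_map id ?_
      rintro u _ (rfl | rfl)
      · rcases htop u with ⟨x, rfl⟩ | ⟨x, rfl⟩
        · exact .rel _ _ (by simpa only [id, hat] using .top ((hfα _ _).2 (.inr rfl)))
        · rw [hao]
          exact .refl _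
      · rcases u with u | u
        · exact .refl _
        · exact .rel _ _ (.bottom ((hgβ _ _).2 (.inr rfl)))
  have hsymm : ∀ u v, Relation.EqvGen (fun u v => v = a u ∨ v = b u) u v ↔
      Relation.EqvGen (fun u v => v = b u ∨ v = a u) u v := by
    intro u v
    exact ⟨eqvGen_map id fun _ _ h => .rel _ _ h.symm, eqvGen_map id fun _ _ h => .rel _ _ h.symm⟩
  have houter : ∀ v : ProductVertex m n k, (a v = v ∨ b v = v) ↔ ∃ x, v = outerVertex n x := by
    intro v
    rw [hafix, hbfix]
    constructor
    · rintro (⟨x, rfl⟩ | ⟨x, rfl⟩)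
      · exact ⟨.inr x, rfl⟩
      · exact ⟨.inl x, rfl⟩
    · rintro ⟨x | x, rfl⟩
      · exact .inr ⟨x, rfl⟩
      · exact .inl ⟨x, rfl⟩
  have hoinj : Function.Injective (outerVertex n : Fin m ⊕ Fin k → _) := by
    rintro (x | x) (y | y) h <;> simp_all [outerVertex]
  refine ncard_of_partner _ fun x => ?_
  have main : ∃ y, y ≠ outerVertex n x ∧ (a y = y ∨ b y = y) ∧
      Relation.EqvGen (fun u v => v = a u ∨ v = b u) (outerVertex n x) y ∧
      ∀ z, Relation.EqvGen (fun u v => v = a u ∨ v = b u) (outerVertex n x) z →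
        (a z = z ∨ b z = z) → z = outerVertex n x ∨ z = y := by
    rcases x with x | x
    · refine two_fixed_points a b haa hbb _ (hbo x) ?_
      rw [Ne, hafix]
      rintro ⟨y, hy⟩
      simp [outerVertex] at hy
    · have := two_fixed_points b a hbb haa (outerVertex n (.inr x)) (hao x) (by
        rw [Ne, hbfix]
        rintro ⟨y, hy⟩
        simp [outerVertex] at hy)
      obtain ⟨y, h1, h2, h3, h4⟩ := this
      exact ⟨y, h1, h2.symm, (hsymm _ _).2 h3, fun z hz hz' => h4 z ((hsymm _ _).1 hz) hz'.symm⟩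
  obtain ⟨y, h1, h2, h3, h4⟩ := main
  obtain ⟨y, rfl⟩ := (houter y).1 h2
  refine ⟨y, fun h => h1 (congrArg _ h), fun z => ⟨fun hz => ?_, ?_⟩⟩
  · rcases h4 (outerVertex n z) ((hE _ _).1 hz) ((houter _).2 ⟨z, rfl⟩) with h | h
    · exact .inl (hoinj h)
    · exact .inr (hoinj h)
  · rintro (rfl | rfl)
    · exact Setoid.refl' _ _
    · exact (hE _ _).2 h3

theorem Partn.IsBrauer.star {m n : ℕ} {α : Partn m n} (hα : α.IsBrauer) :
    (Partn.star α).IsBrauer := by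
  obtain ⟨f, hff, hf, hfα⟩ := exists_partner α hα
  refine ncard_of_partner _ fun x => ⟨(f x.swap).swap, fun h => hf x.swap ?_, fun z => ?_⟩
  · simpa using congrArg Sum.swap h
  · refine (hfα x.swap z.swap).trans (or_congr ?_ ?_)
    · exact (Sum.swap_leftInverse.injective).eq_iff
    · rw [← (Sum.swap_leftInverse.injective).eq_iff (a := z), Sum.swap_swap]

/-! ### The Brauer category -/

/-- The hom-set `𝓑 m n` of all Brauer partitions of `[m] ∪ [n]'`. -/
def Brauer (m n : ℕ) : Type := {α : Partn m n // α.IsBrauer}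

/-- Composition in the Brauer category, from left to right. -/
def Brauer.comp {m n k : ℕ} (α : Brauer m n) (β : Brauer n k) : Brauer m k :=
  ⟨Partn.comp α.1 β.1, α.2.comp β.2⟩

def Brauer.star {m n : ℕ} (α : Brauer m n) : Brauer n m :=
  ⟨Partn.star α.1, α.2.star⟩

theorem Brauer.comp_assoc {m n k l : ℕ} (α : Brauer m n) (β : Brauer n k) (γ : Brauer k l) :
    (α.comp β).comp γ = α.comp (β.comp γ) :=
  Subtype.ext (Partn.comp_assoc α.1 β.1 γ.1)

theorem Brauer.comp_star_comp {m n : ℕ} (α : Brauer m n) : (α.comp α.star).comp α = α :=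
  Subtype.ext (Partn.comp_star_comp α.1)

theorem Brauer.sandwich_assoc {m n : ℕ} (σ : Brauer n m) (α β γ : Brauer m n) :
    (((α.comp σ).comp β).comp σ).comp γ = (α.comp σ).comp ((β.comp σ).comp γ) := by
  simp only [Brauer.comp_assoc]

/-- If `x` and `y` are regular elements of a sandwich semigroup, then so is their product. -/
theorem Brauer.sandwich_regular {m n : ℕ} (σ : Brauer n m) (x y u v : Brauer m n)
    (hx : x = (((x.comp σ).comp u).comp σ).comp x)
    (hy : y = (((y.comp σ).comp v).comp σ).comp y) : ∃ w : Brauer m n,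
    (x.comp σ).comp y =
      (((((x.comp σ).comp y).comp σ).comp w).comp σ).comp ((x.comp σ).comp y) := by
  let s : Brauer n m := σ.comp (x.comp (σ.comp (y.comp σ)))
  have hs : s.comp (s.star.comp s) = s := by
    rw [← Brauer.comp_assoc, Brauer.comp_star_comp]
  have hL : (x.comp σ).comp y = (x.comp (σ.comp u)).comp (s.comp (v.comp (σ.comp y))) := by
    calc (x.comp σ).comp y
        = (((((x.comp σ).comp u).comp σ).comp x).comp σ).comp
            ((((y.comp σ).comp v).comp σ).comp y) := by rw [← hx, ← hy]
      _ = _ := by simp only [s, Brauer.comp_assoc]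
  have hR : (((((x.comp σ).comp y).comp σ).comp s.star).comp σ).comp ((x.comp σ).comp y) =
      (x.comp (σ.comp u)).comp ((s.comp (s.star.comp s)).comp (v.comp (σ.comp y))) := by
    calc (((((x.comp σ).comp y).comp σ).comp s.star).comp σ).comp ((x.comp σ).comp y)
        = (((((((((x.comp σ).comp u).comp σ).comp x).comp σ).comp y).comp σ).comp
            s.star).comp σ).comp ((x.comp σ).comp ((((y.comp σ).comp v).comp σ).comp y)) := by
          rw [← hx, ← hy]
      _ = _ := by simp only [s, Brauer.comp_assoc]
  refine ⟨s.star, ?_⟩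
  rw [hR, hs]
  exact hL

/-- Green's preorder `≤_L` on the Brauer category.  As this is a category, no identity has to be
adjoined. -/
def Brauer.LeL {m n k : ℕ} (α : Brauer m k) (β : Brauer n k) : Prop :=
  ∃ γ : Brauer m n, α = γ.comp β

/-- Green's relation `L` on the Brauer category. -/
def Brauer.RelL {m n k : ℕ} (α : Brauer m k) (β : Brauer n k) : Prop :=
  α.LeL β ∧ β.LeL α

/-! ### Semigroups -/

/-- Von Neumann regularity of an element of a semigroup. -/
def IsRegularElt {T : Type*} [Semigroup T] (x : T) : Prop :=
  ∃ y : T, x = x * y * x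

/-- A mid-identity of a semigroup. -/
def IsMidIdentity {T : Type*} [Semigroup T] (u : T) : Prop :=
  ∀ x y : T, x * y = x * u * y

/-- The natural partial order on the idempotents of a semigroup. -/
def NaturalLE {T : Type*} [Semigroup T] (e f : T) : Prop :=
  e = e * f ∧ e = f * e

/-- A semigroup is MI-dominated if it is regular and each of its idempotents lies below a
mid-identity in the natural order. -/
def MIDominated (T : Type*) [Semigroup T] : Prop :=
  (∀ x : T, IsRegularElt x) ∧
    ∀ e : T, IsIdempotentElem e → ∃ u : T, IsMidIdentity u ∧ NaturalLE e u

/-! ### Sandwich semigroups in the Brauer category -/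

/-- The underlying set of the sandwich semigroup of `σ`: the hom-set `𝓑 m n`. -/
def Sandwich {m n : ℕ} (_σ : Brauer n m) : Type := Brauer m n

/-- The sandwich product `α ⋆ β = α σ β`. -/
instance {m n : ℕ} (σ : Brauer n m) : Semigroup (Sandwich σ) where
  mul α β := Brauer.comp (Brauer.comp α σ) β
  mul_assoc := Brauer.sandwich_assoc σ

/-- The regular elements of a sandwich semigroup in the Brauer category form a subsemigroup. -/
def regSubsemigroup {m n : ℕ} (σ : Brauer n m) : Subsemigroup (Sandwich σ) where
  carrier := {α | IsRegularElt α}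
  mul_mem' := by
    rintro x y ⟨u, hx⟩ ⟨v, hy⟩
    exact Brauer.sandwich_regular σ x y u v hx hy

/-- The set `P₂ = {α : σα L α}`. -/
def P2 {m n : ℕ} (σ : Brauer n m) : Set (Brauer m n) :=
  {α | Brauer.RelL (σ.comp α) α}

end SandwichBrauer

namespace SandwichBrauer

/-! ### Containment of Brauer partitions, and the involution -/

/-! Call a block inside one row a hook, and any other block a transversal. Everything reduces to
pre-inverses of `σ`: if `σλσ = σ`, then `λσλ` is regular and is a mid-identity, because `xσ(λσλ)σy`
collapses to `xσy`. The task is to choose `λ` so that it also fixes a given element.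

The core is `Brauer.exists_preinverse_fixing`: if `α = τσα`, some pre-inverse `λ` satisfies `λσα =
α`. When every lower hook of `σ` is an upper hook of `α`, `λ = σ*` works. Otherwise take an
unmatched lower hook `{x', y'}` of `σ`. It cannot join two transversals of `α`, so, up to swapping
`x` and `y`, `α` has an upper hook `{x, u}`. Let `π_xy` be the projection with hooks `{x, y}`, `{x',
y'}` and identity elsewhere. Replacing `α` by `π_xy α` leaves `σα` unchanged and reduces the
unmatched hooks. If `λ` serves `π_xy α`, then `π_xu π_xy λ` serves `α`, since `σ π_xu π_xy = σ` and
`π_xu π_xy α = α`.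

An idempotent `e = eσe` is fixed on the left by some pre-inverse `λ₁` and, by the involution, on the
right by some `λ₂`; then `λ₁σλ₂` handles both sides. -/

theorem Brauer.eq_of_le {m n : ℕ} {α β : Brauer m n} (h : ∀ p q, α.1 p q → β.1 p q) : α = β := by
  obtain ⟨f, -, hf, hfα⟩ := exists_partner α.1 α.2
  obtain ⟨g, -, -, hgβ⟩ := exists_partner β.1 β.2
  -- Containment suffices for equality because all blocks have the same size: the `α`-partner of `p`
  -- is already its `β`-partner.
  have hfg : ∀ p, f p = g p := fun p =>
    ((hgβ p (f p)).1 (h _ _ ((hfα p (f p)).2 (.inr rfl)))).resolve_left (hf p)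
  exact Subtype.ext (Setoid.ext fun p q => by rw [hfα, hgβ, hfg])

theorem Brauer.star_star {m n : ℕ} (α : Brauer m n) : α.star.star = α :=
  Brauer.eq_of_le fun p q h => by
    change α.1 p.swap.swap q.swap.swap at h
    simpa only [Sum.swap_swap] using h

theorem Brauer.star_comp {m n k : ℕ} (α : Brauer m n) (β : Brauer n k) :
    (α.comp β).star = β.star.comp α.star := by
  refine Brauer.eq_of_le fun p q h => ?_
  -- Reflection of the product graph, reversing its three rows.
  let f : ProductVertex m n k → ProductVertex k n m :=
    Sum.elim (Sum.inr ∘ Sum.inr) (Sum.elim (Sum.inr ∘ Sum.inl) Sum.inl)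
  have hf : ∀ p : Fin k ⊕ Fin m, f (outerVertex n p.swap) = outerVertex n p := by
    rintro (p | p) <;> rfl
  have ht : ∀ p : Fin m ⊕ Fin n, f (topVertex k p) = bottomVertex k p.swap := by
    rintro (p | p) <;> rfl
  have hb : ∀ p : Fin n ⊕ Fin k, f (bottomVertex m p) = topVertex m p.swap := by
    rintro (p | p) <;> rfl
  change Relation.EqvGen (ProductEdge β.star.1 α.star.1) (outerVertex n p) (outerVertex n q)
  rw [← hf, ← hf]
  refine eqvGen_map f ?_
    (show Relation.EqvGen (ProductEdge α.1 β.1) (outerVertex n p.swap) (outerVertex n q.swap) from h)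
  rintro _ _ (⟨h⟩ | ⟨h⟩)
  · rename_i a b
    rw [ht, ht]
    refine .rel _ _ (.bottom ?_)
    change α.1 a.swap.swap b.swap.swap
    simpa only [Sum.swap_swap] using h
  · rename_i a b
    rw [hb, hb]
    refine .rel _ _ (.top ?_)
    change β.1 a.swap.swap b.swap.swap
    simpa only [Sum.swap_swap] using h

/-! ### Hooks in products -/

theorem Brauer.comp_inl_of_inl {m n k : ℕ} {α : Brauer m n} (β : Brauer n k) {x y : Fin m}
    (h : α.1 (.inl x) (.inl y)) : (α.comp β).1 (.inl x) (.inl y) :=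
  .rel _ _ (.top (β := β.1) h)

theorem Brauer.comp_inr_of_inr {m n k : ℕ} (α : Brauer m n) {β : Brauer n k} {x y : Fin k}
    (h : β.1 (.inr x) (.inr y)) : (α.comp β).1 (.inr x) (.inr y) :=
  .rel _ _ (.bottom (α := α.1) h)

/-- If `β` has the blocks `{v, v'}` for `v ∉ S`, and the blocks of `α` that meet `S` are contained in
blocks of `β α`, then `β α = α`. -/
theorem Brauer.comp_eq_right {m k : ℕ} (β : Brauer m m) (α : Brauer m k) (S : Set (Fin m))
    (hS : ∀ v ∉ S, β.1 (.inl v) (.inr v))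
    (h : ∀ v ∈ S, ∀ q, α.1 (.inl v) q → (β.comp α).1 (.inl v) q) : β.comp α = α := by
  symm
  refine Brauer.eq_of_le fun p q hpq => ?_
  -- Off `S`, each vertex of the product is joined to its copy in the graph of `α`, so blocks of `α`
  -- that miss `S` carry over.
  have hC : ∀ p : Fin m ⊕ Fin k, (∀ v ∈ S, p ≠ .inl v) →
      Relation.EqvGen (ProductEdge β.1 α.1) (outerVertex m p) (bottomVertex m p) := by
    rintro (v | v) hv
    · exact .rel _ _ (.top (hS v fun hvS => hv v hvS rfl))
    · exact .refl _
  by_cases hp : ∃ v ∈ S, p = .inl v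
  · obtain ⟨v, hv, rfl⟩ := hp
    exact h v hv q hpq
  by_cases hq : ∃ v ∈ S, q = .inl v
  · obtain ⟨v, hv, rfl⟩ := hq
    exact Setoid.symm' _ (h v hv p (Setoid.symm' _ hpq))
  push Not at hp hq
  exact .trans _ _ _ (hC p hp) (.trans _ _ _ (.rel _ _ (.bottom hpq)) (.symm _ _ (hC q hq)))

/-- If every lower hook of `σ` is an upper hook of `α`, then `σ* σ` fixes `α`. -/
theorem Brauer.star_comp_self_comp {m n k : ℕ} (σ : Brauer n m) (α : Brauer m k)
    (h : ∀ x y, σ.1 (.inr x) (.inr y) → α.1 (.inl x) (.inl y)) :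
    (σ.star.comp σ).comp α = α := by
  obtain ⟨f, hff, hf, hfσ⟩ := exists_partner σ.1 σ.2
  obtain ⟨g, hgg, hg, hgα⟩ := exists_partner α.1 α.2
  -- `S` consists of the vertices on lower hooks of `σ`. Every other `v` lies on a transversal of
  -- `σ`, which `σ*` and `σ` traverse back and forth to give `{v, v'}`.
  refine Brauer.comp_eq_right _ _ {v | ∃ w, f (.inr v) = .inr w} ?_ ?_
  · intro v hv
    rcases hw : f (.inr v) with w | w
    · have h1 : σ.1 (.inr v) (.inl w) := (hfσ _ _).2 (.inr hw.symm)
      exact .trans _ _ _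
        (.rel _ _ (.top (α := σ.star.1) (β := σ.1) (x := .inl v) (y := .inr w) h1))
        (.rel _ _ (.bottom (α := σ.star.1) (β := σ.1) (σ.1.symm' h1)))
    · exact absurd ⟨w, hw⟩ hv
  · rintro v ⟨w, hw⟩ q hq
    have h1 : σ.1 (.inr v) (.inr w) := (hfσ _ _).2 (.inr hw.symm)
    rcases (hgα _ _).1 hq with rfl | rfl
    · exact Setoid.refl' _ _
    · have hvw : v ≠ w := fun e => hf (.inr v) (by rw [hw, e])
      have h2 := ((hgα _ _).1 (h v w h1)).resolve_left fun e => hvw (Sum.inl_injective e).symm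
      rw [← h2]
      refine Brauer.comp_inl_of_inl α (Brauer.comp_inl_of_inl σ ?_)
      exact h1

/-! ### Hook projections -/

/-- The set partition whose blocks are the orbits of an involution. -/
def orbitSetoid {X : Type*} (f : X → X) (hf : ∀ x, f (f x) = x) : Setoid X where
  r x y := y = x ∨ y = f x
  iseqv :=
    { refl := fun _ => .inl rfl
      symm := by
        rintro x y (rfl | rfl)
        · exact .inl rfl
        · exact .inr (hf x).symm
      trans := by
        rintro x y z (rfl | rfl) (rfl | rfl)
        · exact .inl rfl
        · exact .inr rfl
        · exact .inr rfl
        · exact .inl (hf x) }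

/-- The involution with orbits `{x, y}`, `{x', y'}` and `{v, v'}` for the other `v`. -/
def hookMap {m : ℕ} (x y : Fin m) : Fin m ⊕ Fin m → Fin m ⊕ Fin m :=
  Sum.elim (fun v => if v = x then .inl y else if v = y then .inl x else .inr v)
    (fun v => if v = x then .inr y else if v = y then .inr x else .inl v)

theorem hookMap_hookMap {m : ℕ} (x y : Fin m) (p : Fin m ⊕ Fin m) :
    hookMap x y (hookMap x y p) = p := by
  rcases p with v | v <;> simp only [hookMap, Sum.elim_inl, Sum.elim_inr] <;>
    split_ifs <;> simp_all

/-- The projection with blocks `{x, y}`, `{x', y'}` and `{v, v'}` for the other `v`. -/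
def hookProj {m : ℕ} (x y : Fin m) (hxy : x ≠ y) : Brauer m m :=
  ⟨orbitSetoid (hookMap x y) (hookMap_hookMap x y), ncard_of_partner _ fun p =>
    ⟨hookMap x y p, by
      rcases p with v | v <;> simp only [hookMap, Sum.elim_inl, Sum.elim_inr] <;>
        split_ifs <;> simp_all [eq_comm], fun _ => Iff.rfl⟩⟩

theorem hookProj_inl {m : ℕ} {x y : Fin m} (hxy : x ≠ y) :
    (hookProj x y hxy).1 (.inl x) (.inl y) :=
  .inr (by simp [hookMap])

theorem hookProj_inr {m : ℕ} {x y : Fin m} (hxy : x ≠ y) :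
    (hookProj x y hxy).1 (.inr x) (.inr y) :=
  .inr (by simp [hookMap])

theorem hookProj_inl_inr {m : ℕ} {x y : Fin m} (hxy : x ≠ y) {v : Fin m} (hx : v ≠ x)
    (hy : v ≠ y) : (hookProj x y hxy).1 (.inl v) (.inr v) :=
  .inr (by simp [hookMap, hx, hy])

theorem star_hookProj {m : ℕ} {x y : Fin m} (hxy : x ≠ y) :
    (hookProj x y hxy).star = hookProj x y hxy := by
  symm
  refine Brauer.eq_of_le fun p q h => ?_
  rcases h with rfl | rfl
  · exact Setoid.refl' _ _
  · refine .inr ?_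
    rcases p with v | v <;> simp only [hookMap, Sum.elim_inl, Sum.elim_inr, Sum.swap_inl,
      Sum.swap_inr] <;> split_ifs <;> rfl

theorem Brauer.eq_or_eq_of_hook {m k : ℕ} (α : Brauer m k) {p q r : Fin m ⊕ Fin k} (hpq : p ≠ q)
    (h : α.1 p q) (hr : α.1 p r) : r = p ∨ r = q := by
  obtain ⟨g, -, -, hg⟩ := exists_partner α.1 α.2
  have h1 := ((hg _ _).1 h).resolve_left hpq.symm
  rw [h1]
  exact (hg _ _).1 hr

/-- The projection is the identity away from `x` and `y`, and its upper hook supplies the only block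
of `α` that meets them. -/
theorem hookProj_comp {m k : ℕ} {x y : Fin m} (hxy : x ≠ y) (α : Brauer m k)
    (h : α.1 (.inl x) (.inl y)) : (hookProj x y hxy).comp α = α := by
  have h1 := Brauer.comp_inl_of_inl α (hookProj_inl hxy)
  have hne : (.inl x : Fin m ⊕ Fin k) ≠ .inl y := fun e => hxy (Sum.inl_injective e)
  refine Brauer.comp_eq_right _ _ {x, y} ?_ ?_
  · intro v hv
    simp only [Set.mem_insert_iff, Set.mem_singleton_iff, not_or] at hv
    exact hookProj_inl_inr hxy hv.1 hv.2
  · rintro v (rfl | rfl) q hq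
    · rcases α.eq_or_eq_of_hook hne h hq with rfl | rfl
      · exact Setoid.refl' _ _
      · exact h1
    · rcases α.eq_or_eq_of_hook hne.symm (α.1.symm' h) hq with rfl | rfl
      · exact Setoid.refl' _ _
      · exact Setoid.symm' _ h1

/-- The product of the two projections has blocks `{x, u}`, `{x', y'}`, `{y, u'}` and `{v, v'}` for
the other `v`. Its upper hook restores `{x, u}`, and the block of `α` at `y` is recovered by a
detour through `u` and `x`. -/
theorem hookProj_comp_hookProj_comp {m k : ℕ} {x y u : Fin m} (hxy : x ≠ y) (hxu : x ≠ u)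
    (hyu : y ≠ u) (α : Brauer m k) (h : α.1 (.inl x) (.inl u)) :
    (hookProj x u hxu).comp ((hookProj x y hxy).comp α) = α := by
  have hne : (.inl x : Fin m ⊕ Fin k) ≠ .inl u := fun e => hxu (Sum.inl_injective e)
  rw [← Brauer.comp_assoc]
  set β := (hookProj x u hxu).comp (hookProj x y hxy) with hβ
  have hxu' : β.1 (.inl x) (.inl u) := Brauer.comp_inl_of_inl _ (hookProj_inl hxu)
  have hxy' : β.1 (.inr x) (.inr y) := Brauer.comp_inr_of_inr _ (hookProj_inr hxy)
  have hyu' : β.1 (.inl y) (.inr u) :=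
    .trans _ _ _ (.rel _ _ (.top (hookProj_inl_inr hxu hxy.symm hyu)))
      (.trans _ _ _ (.rel _ _ (.bottom (Setoid.symm' _ (hookProj_inl hxy))))
        (.trans _ _ _ (.rel _ _ (.top (hookProj_inr hxu)))
          (.rel _ _ (.bottom (hookProj_inl_inr hxy hxu.symm hyu.symm)))))
  have hv' : ∀ v, v ≠ x → v ≠ y → v ≠ u → β.1 (.inl v) (.inr v) := fun v hx hy hu =>
    .trans _ _ _ (.rel _ _ (.top (hookProj_inl_inr hxu hx hu)))
      (.rel _ _ (.bottom (hookProj_inl_inr hxy hx hy)))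
  have h1 := Brauer.comp_inl_of_inl α hxu'
  refine Brauer.comp_eq_right _ _ {x, y, u} ?_ ?_
  · intro v hv
    simp only [Set.mem_insert_iff, Set.mem_singleton_iff, not_or] at hv
    exact hv' v hv.1 hv.2.1 hv.2.2
  · rintro v (rfl | rfl | rfl) q hq
    · rcases α.eq_or_eq_of_hook hne h hq with rfl | rfl
      · exact Setoid.refl' _ _
      · exact h1
    -- Here `v` is the former `y`. The walk goes down to `u`, along the hook `{x, u}` of `α` to `x`,
    -- along the lower hook of `β` back to `y`, then along the block of `α` to `q`.
    · have h2 : Relation.EqvGen (ProductEdge β.1 α.1) (outerVertex m (.inl v))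
          (bottomVertex m q) :=
        .trans _ _ _ (.rel _ _ (.top hyu')) (.trans _ _ _ (.rel _ _ (.bottom (α.1.symm' h)))
          (.trans _ _ _ (.rel _ _ (.top hxy')) (.rel _ _ (.bottom hq))))
      rcases q with w | w
      · rcases eq_or_ne w v with rfl | hwv
        · exact Setoid.refl' _ _
        have hxv : (.inl x : Fin m ⊕ Fin k) ≠ .inl v := fun e => hxy (Sum.inl_injective e)
        have huv : (.inl u : Fin m ⊕ Fin k) ≠ .inl v := fun e => hyu (Sum.inl_injective e).symm
        -- An upper `q` needs one more edge up through `{w, w'}`. This requires `w ≠ x` and `w ≠ u`,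
        -- which holds because `{x, u}` is a whole block of `α`.
        refine .trans _ _ _ h2 (.symm _ _ (.rel _ _ (.top (hv' w ?_ hwv ?_))))
        · rintro rfl
          rcases α.eq_or_eq_of_hook hne h (α.1.symm' hq) with e | e
          exacts [hxv e.symm, huv e.symm]
        · rintro rfl
          rcases α.eq_or_eq_of_hook hne.symm (α.1.symm' h) (α.1.symm' hq) with e | e
          exacts [huv e.symm, hxv e.symm]
      · exact h2
    · rcases α.eq_or_eq_of_hook hne.symm (α.1.symm' h) hq with rfl | rfl
      · exact Setoid.refl' _ _
      · exact Setoid.symm' _ h1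

theorem comp_hookProj {n m : ℕ} {x y : Fin m} (hxy : x ≠ y) (σ : Brauer n m)
    (h : σ.1 (.inr x) (.inr y)) : σ.comp (hookProj x y hxy) = σ := by
  have h1 := congrArg Brauer.star (hookProj_comp hxy σ.star h)
  rwa [Brauer.star_comp, Brauer.star_star, star_hookProj] at h1

theorem comp_hookProj_comp_hookProj {n m : ℕ} {x y u : Fin m} (hxy : x ≠ y) (hxu : x ≠ u)
    (hyu : y ≠ u) (σ : Brauer n m) (h : σ.1 (.inr x) (.inr y)) :
    (σ.comp (hookProj x u hxu)).comp (hookProj x y hxy) = σ := by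
  -- The involution reverses the product, so `y` and `u` exchange roles.
  have h1 := congrArg Brauer.star (hookProj_comp_hookProj_comp hxu hxy hyu.symm σ.star h)
  rwa [Brauer.star_comp, Brauer.star_comp, Brauer.star_star, star_hookProj, star_hookProj] at h1

/-! ### Pre-inverses that fix a given Brauer partition -/

/-- A lower hook of `σ` cannot join two transversals of `α` if `σ α` is `L`-related to `α`. -/
theorem Brauer.exists_hook_of_eq {m n k : ℕ} (σ : Brauer n m) (α : Brauer m k) (τ : Brauer m n)
    (h : α = τ.comp (σ.comp α)) {x y : Fin m} (hxy : x ≠ y)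
    (hσ : σ.1 (.inr x) (.inr y)) :
    (∃ u, u ≠ x ∧ α.1 (.inl x) (.inl u)) ∨ ∃ u, u ≠ y ∧ α.1 (.inl y) (.inl u) := by
  obtain ⟨g, hgg, hg, hgα⟩ := exists_partner α.1 α.2
  have hgα' : ∀ p, α.1 p (g p) := fun p => (hgα _ _).2 (.inr rfl)
  rcases hx : g (.inl x) with u | v
  · exact .inl ⟨u, fun e => hg (.inl x) (by rw [hx, e]), hx ▸ hgα' _⟩
  rcases hy : g (.inl y) with u | w
  · exact .inr ⟨u, fun e => hg (.inl y) (by rw [hy, e]), hy ▸ hgα' _⟩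
  have hv : α.1 (.inl x) (.inr v) := hx ▸ hgα' _
  have hw : α.1 (.inl y) (.inr w) := hy ▸ hgα' _
  -- If `x` and `y` both lie on transversals of `α`, the hook of `σ` joins their lower ends in `σα`,
  -- hence in `τσα = α`. Then `y` is in the block of `x`, which yields the first alternative with `u
  -- = y`.
  have h1 : (σ.comp α).1 (.inr v) (.inr w) :=
    .trans _ _ _ (.rel _ _ (.bottom (α.1.symm' hv)))
      (.trans _ _ _ (.rel _ _ (.top hσ)) (.rel _ _ (.bottom hw)))
  have h2 : α.1 (.inr v) (.inr w) := h ▸ Brauer.comp_inr_of_inr τ h1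
  exact .inl ⟨y, hxy.symm, α.1.trans' hv (α.1.trans' h2 (α.1.symm' hw))⟩

/-- The lower hooks of `σ` that are not upper hooks of `α`. -/
def Brauer.unmatchedHooks {m n k : ℕ} (σ : Brauer n m) (α : Brauer m k) : Set (Fin m × Fin m) :=
  {p | σ.1 (.inr p.1) (.inr p.2) ∧ ¬ α.1 (.inl p.1) (.inl p.2)}

/-- Left multiplication by the projection creates the hook `{x, y}` and keeps every upper hook of
`α` that avoids `x` and `y`. Any hook lost meets `x` or `y`, where the only lower hook of `σ` is
`{x', y'}` itself. -/
theorem Brauer.unmatchedHooks_hookProj_comp {m n k : ℕ} {σ : Brauer n m} (α : Brauer m k)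
    {x y : Fin m} (hxy : x ≠ y) (hσ : σ.1 (.inr x) (.inr y)) (hα : ¬ α.1 (.inl x) (.inl y)) :
    (σ.unmatchedHooks ((hookProj x y hxy).comp α)).ncard < (σ.unmatchedHooks α).ncard := by
  have hxy' := Brauer.comp_inl_of_inl α (hookProj_inl hxy)
  have hne : (.inr x : Fin n ⊕ Fin m) ≠ .inr y := fun e => hxy (Sum.inr_injective e)
  refine Set.ncard_lt_ncard (Set.ssubset_iff_of_subset ?_ |>.2
    ⟨(x, y), ⟨hσ, hα⟩, fun h => h.2 hxy'⟩) (Set.toFinite _)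
  rintro ⟨z, w⟩ ⟨h1, h2⟩
  refine ⟨h1, fun h3 => h2 ?_⟩
  have key : ∀ z w, σ.1 (.inr z) (.inr w) → z = x ∨ z = y →
      ((hookProj x y hxy).comp α).1 (.inl z) (.inl w) := by
    rintro z w h (rfl | rfl)
    · rcases σ.star.eq_or_eq_of_hook (p := .inl z) (q := .inl y) (r := .inl w)
        (fun e => hxy (Sum.inl_injective e)) hσ h with e | e <;> cases e
      · exact Setoid.refl' _ _
      · exact hxy'
    · rcases σ.star.eq_or_eq_of_hook (p := .inl z) (q := .inl x) (r := .inl w)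
        (fun e => hxy (Sum.inl_injective e).symm) (σ.1.symm' hσ) h with e | e <;> cases e
      · exact Setoid.refl' _ _
      · exact Setoid.symm' _ hxy'
  by_cases hz : z = x ∨ z = y
  · exact key z w h1 hz
  by_cases hw : w = x ∨ w = y
  · exact Setoid.symm' _ (key w z (σ.1.symm' h1) hw)
  push Not at hz hw
  exact .trans _ _ _ (.rel _ _ (.top (hookProj_inl_inr hxy hz.1 hz.2)))
    (.trans _ _ _ (.rel _ _ (.bottom h3))
      (.symm _ _ (.rel _ _ (.top (hookProj_inl_inr hxy hw.1 hw.2)))))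

theorem Brauer.exists_preinverse_fixing {m n k : ℕ} (σ : Brauer n m) (α : Brauer m k)
    (τ : Brauer m n) (h : α = τ.comp (σ.comp α)) :
    ∃ l : Brauer m n, (σ.comp l).comp σ = σ ∧ l.comp (σ.comp α) = α := by
  -- The factor `τ` is generalized along with `α`: passing to `π_xy α` replaces it by `π_xy τ`.
  induction hN : (σ.unmatchedHooks α).ncard using Nat.strong_induction_on generalizing α τ with
  | _ N ih =>
  subst hN
  by_cases hM : ∀ x y, σ.1 (.inr x) (.inr y) → α.1 (.inl x) (.inl y)
  · exact ⟨σ.star, σ.comp_star_comp, by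
      rw [← Brauer.comp_assoc, Brauer.star_comp_self_comp σ α hM]⟩
  push Not at hM
  obtain ⟨x₀, y₀, hσ₀, hα₀⟩ := hM
  -- The unmatched hook is oriented so that `x` is the end lying on an upper hook of `α`.
  obtain ⟨x, y, u, hσ, hα, hux, hu⟩ : ∃ x y u, σ.1 (.inr x) (.inr y) ∧
      ¬ α.1 (.inl x) (.inl y) ∧ u ≠ x ∧ α.1 (.inl x) (.inl u) := by
    have hxy₀ : x₀ ≠ y₀ := by
      rintro rfl
      exact hα₀ (α.1.refl' _)
    rcases Brauer.exists_hook_of_eq σ α τ h hxy₀ hσ₀ with ⟨u, h1, h2⟩ | ⟨u, h1, h2⟩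
    · exact ⟨x₀, y₀, u, hσ₀, hα₀, h1, h2⟩
    · exact ⟨y₀, x₀, u, σ.1.symm' hσ₀, fun h => hα₀ (α.1.symm' h), h1, h2⟩
  have hxy : x ≠ y := by
    rintro rfl
    exact hα (α.1.refl' _)
  have hyu : y ≠ u := by
    rintro rfl
    exact hα hu
  have hσα : σ.comp ((hookProj x y hxy).comp α) = σ.comp α := by
    rw [← Brauer.comp_assoc, comp_hookProj hxy σ hσ]
  obtain ⟨l, hl1, hl2⟩ := ih _ (Brauer.unmatchedHooks_hookProj_comp α hxy hσ hα)
    ((hookProj x y hxy).comp α) ((hookProj x y hxy).comp τ)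
    (by rw [hσα, Brauer.comp_assoc, ← h]) rfl
  -- On the right of `σ` the two projections are absorbed. On the left of `α`, `l` returns `π_xy α`,
  -- the repeated `π_xy` is absorbed, and `π_xu` then recovers `α`.
  refine ⟨(hookProj x u hux.symm).comp ((hookProj x y hxy).comp l), ?_, ?_⟩
  · rw [← Brauer.comp_assoc, ← Brauer.comp_assoc,
      comp_hookProj_comp_hookProj hxy hux.symm hyu σ hσ, hl1]
  · rw [hσα] at hl2
    rw [Brauer.comp_assoc, Brauer.comp_assoc, hl2,
      hookProj_comp hxy _ (Brauer.comp_inl_of_inl α (hookProj_inl hxy)),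
      hookProj_comp_hookProj_comp hxy hux.symm hyu α hu]

theorem Brauer.exists_preinverse_fixing_right {m n k : ℕ} (σ : Brauer n m) (α : Brauer k n)
    (τ : Brauer m n) (h : α = (α.comp σ).comp τ) :
    ∃ l : Brauer m n, (σ.comp l).comp σ = σ ∧ (α.comp σ).comp l = α := by
  obtain ⟨l, h1, h2⟩ := Brauer.exists_preinverse_fixing σ.star α.star τ.star (by
    rw [← Brauer.star_comp, ← Brauer.star_comp, ← h])
  refine ⟨l.star, ?_, ?_⟩
  · have := congrArg Brauer.star h1
    rwa [Brauer.star_comp, Brauer.star_comp, Brauer.star_star, ← Brauer.comp_assoc] at this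
  · have := congrArg Brauer.star h2
    rwa [Brauer.star_comp, Brauer.star_comp, Brauer.star_star, Brauer.star_star] at this

/-! ### Mid-identities of the regular subsemigroup -/

theorem isRegularElt_regSubsemigroup {m n : ℕ} {σ : Brauer n m} (x : regSubsemigroup σ) :
    IsRegularElt x := by
  obtain ⟨x, y, hx⟩ := x
  -- The witness `y` need not be regular itself; `y * x * y` is regular and serves equally well.
  have hy : y * x * y = y * x * y * x * (y * x * y) := by
    calc y * x * y = y * (x * y * x) * y := by rw [← hx]
      _ = y * (x * y * (x * y * x)) * y := by rw [← hx, ← hx]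
      _ = _ := by simp only [mul_assoc]
  refine ⟨⟨y * x * y, x, hy⟩, Subtype.ext ?_⟩
  change x = x * (y * x * y) * x
  calc x = x * y * x := hx
    _ = x * y * (x * y * x) := congrArg (x * y * ·) hx
    _ = _ := by simp only [mul_assoc]

theorem Brauer.preinverse_comp {m n k : ℕ} {σ : Brauer n m} {l : Brauer m n}
    (hl : (σ.comp l).comp σ = σ) (β : Brauer m k) :
    σ.comp (l.comp (σ.comp β)) = σ.comp β := by
  rw [← Brauer.comp_assoc, ← Brauer.comp_assoc, hl]

theorem Brauer.sandwich_preinverse {m n k l : ℕ} {σ : Brauer n m} {ρ : Brauer m n}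
    (hρ : (σ.comp ρ).comp σ = σ) (x : Brauer k n) (y : Brauer m l) :
    (x.comp σ).comp y = (((x.comp σ).comp ((ρ.comp σ).comp ρ)).comp σ).comp y := by
  simp only [Brauer.comp_assoc, Brauer.preinverse_comp hρ]

theorem Brauer.preinverse_regular {m n : ℕ} {σ : Brauer n m} {l : Brauer m n}
    (hl : (σ.comp l).comp σ = σ) : (l.comp σ).comp l =
      (((((l.comp σ).comp l).comp σ).comp l).comp σ).comp ((l.comp σ).comp l) := by
  simp only [Brauer.comp_assoc, Brauer.preinverse_comp hl]

/-- If `σ λ σ = σ`, then `λ σ λ` is a mid-identity of the regular subsemigroup. -/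
theorem exists_midIdentity_of_preinverse {m n : ℕ} (σ : Brauer n m) (l : Brauer m n)
    (hl : (σ.comp l).comp σ = σ) :
    ∃ u : regSubsemigroup σ, u.1 = (l.comp σ).comp l ∧ IsMidIdentity u :=
  -- A pre-inverse `l` need not be regular in the sandwich semigroup, whereas `lσl` is, with `l` as
  -- witness.
  ⟨⟨(l.comp σ).comp l, l, Brauer.preinverse_regular hl⟩, rfl, fun x y =>
    Subtype.ext (Brauer.sandwich_preinverse hl x.1 y.1)⟩

/-- An idempotent of the sandwich semigroup is fixed on both sides by a pre-inverse of `σ`. -/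
theorem Brauer.exists_preinverse_above {m n : ℕ} (σ : Brauer n m) (e : Brauer m n)
    (he : (e.comp σ).comp e = e) : ∃ l : Brauer m n, (σ.comp l).comp σ = σ ∧
      e = (e.comp σ).comp ((l.comp σ).comp l) ∧ e = (((l.comp σ).comp l).comp σ).comp e := by
  obtain ⟨l₁, h1, h2⟩ := Brauer.exists_preinverse_fixing σ e e (by rw [← Brauer.comp_assoc, he])
  obtain ⟨l₂, h3, h4⟩ := Brauer.exists_preinverse_fixing_right σ e e he.symm
  rw [Brauer.comp_assoc] at h3 h4
  -- Between copies of `σ` all inner factors collapse, so only `l₁` acts on `e` from the left and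
  -- only `l₂` from the right.
  refine ⟨l₁.comp (σ.comp l₂), ?_, ?_, ?_⟩ <;>
    simp only [Brauer.comp_assoc, Brauer.preinverse_comp h1, h2, h3, h4]

end SandwichBrauer

open SandwichBrauer in
theorem mainTheorem9 {m n : ℕ} (σ : SandwichBrauer.Brauer n m) :
    SandwichBrauer.MIDominated (SandwichBrauer.regSubsemigroup σ) ∧
      ∀ α ∈ SandwichBrauer.P2 σ, ∃ l : SandwichBrauer.regSubsemigroup σ,
        SandwichBrauer.IsMidIdentity l ∧
          α = (SandwichBrauer.Brauer.comp l.1 σ).comp α := by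
  refine ⟨⟨isRegularElt_regSubsemigroup, fun e he => ?_⟩, ?_⟩
  · obtain ⟨l, h1, h2, h3⟩ := Brauer.exists_preinverse_above σ e.1 (congrArg Subtype.val he)
    obtain ⟨u, hu, hmid⟩ := exists_midIdentity_of_preinverse σ l h1
    rw [← hu] at h2 h3
    exact ⟨u, hmid, Subtype.ext h2, Subtype.ext h3⟩
  · rintro α ⟨-, τ, hτ⟩
    obtain ⟨l, h1, h2⟩ := Brauer.exists_preinverse_fixing σ α τ hτ
    obtain ⟨u, hu, hmid⟩ := exists_midIdentity_of_preinverse σ l h1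
    refine ⟨u, hmid, ?_⟩
    rw [hu]
    simp only [Brauer.comp_assoc, h2]
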